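/- Let $d\in\mathbb{N}$, let $A\in\mathbb{Q}^{d\times d}$ and let $U\subseteq\mathbb{R}^d$ be such that $\mathcal{L}=(A,U)$ is a \emph{simple} LTI system: (1) $U$ is a bounded convex polytope with $B\cap\operatorname{Span}(U)\subseteq U$ for some open ball $B$ around $\boldsymbol 0$; (2) the spectral radius of $A$ is less than one; (3) some positive power of $A$ has exclusively real spectrum. Assume moreover that all (complex) eigenvalues of $A$ are real and strictly positive and that the set $A^*(U)=\bigcup_{m\ge 0}\sum_{i=0}^m A^i(U)$ of states reachable from $\boldsymbol 0$ is full dimensional, i.e. its affine hull is $\mathbb{R}^d$. Put $A^\infty(U)=\sum_{i=0}^\infty A^i(U)$, let $Q\subseteq\mathbb{R}^d$ be a bounded convex polytope, and assume that $d\ge 2$ or $A^\infty(U)\cap Q\neq\emptyset$. Write \[\mathrm{Cone}(A^\infty(U),Q)=\{\boldsymbol\tau\in\mathbb{R}^d:\ \langle \boldsymbol u,\boldsymbol\tau\rangle\le\langle \boldsymbol v,\boldsymbol\tau\rangle\ \text{ for all } \boldsymbol u\in A^\infty(U),\ \boldsymbol v\in Q\}\] for the cone of separators. For $S\subseteq\mathbb{R}^d$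 let $\max_{\boldsymbol\tau}(S)$ and $\min_{\boldsymbol\tau}(S)$ be the sets of points of $S$ at which $\langle\cdot,\boldsymbol\tau\rangle$ is maximal, respectively minimal, on $S$, and let $\operatorname{Aff}_0(S)$ be the space of all linear combinations of elements of $S$ with coefficients of sum $0$. For an eigenvalue $\lambda$ of $A$ and $0\le j<d$ let $L_{\lambda,j}(\boldsymbol u,\boldsymbol\tau)=\lambda^{-j}\langle (A-\lambda)^jE_\lambda \boldsymbol u,\boldsymbol\tau\rangle$, where $E_\lambda$ is the projection onto the generalised eigenspace of $\lambda$ along the sum of the other generalised eigenspaces; thus \[\langle A^n\boldsymbol u,\boldsymbol\tau\rangle=\sum_{\lambda}\sum_{j=0}^{d-1}\binom nj\lambda^nL_{\lambda,j}(\boldsymbol u,\boldsymbol\tau)\qquad\text{for all } n\in\mathbb{N}.\] Let $\mathrm{Dom}_{\mathcal{L}}(\boldsymbol\tau)$ be the subspace of all $\boldsymbol\tau'\in\mathbb{R}^d$ such that, for all extreme points $\boldsymbol u,\boldsymbol u'$ of $U$ and all $\lambda,j$, if $L_{\lambda,j}(\boldsymbol u-\boldsymbol u',\boldsymbol\tau)=0$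 then $L_{\lambda,j}(\boldsymbol u-\boldsymbol u',\boldsymbol\tau')=0$. Let $\boldsymbol\tau$ be an extremal vector of $K=\mathrm{Cone}(A^\infty(U),Q)$, i.e. $\boldsymbol 0\neq\boldsymbol\tau\in K$, and whenever $\boldsymbol\tau=\boldsymbol x+\boldsymbol y$ with $\boldsymbol x,\boldsymbol y\in K$, both $\boldsymbol x$ and $\boldsymbol y$ are nonnegative multiples of $\boldsymbol\tau$. Then \[\mathrm{Dom}_{\mathcal{L}}(\boldsymbol\tau)\cap\operatorname{Aff}_0\bigl(\max\nolimits_{\boldsymbol\tau}(A^\infty(U))\cup\min\nolimits_{\boldsymbol\tau}(Q)\bigr)^\perp=\operatorname{Span}(\boldsymbol\tau).\] If moreover the vertices of $U$ and of $Q$ have algebraic (for instance rational) coordinates, then the left-hand side is the solution set of a finite system of homogeneous linear equations with algebraic coefficients; hence this system determines $\boldsymbol\tau$ up to scaling. -/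

import Mathlib

open scoped InnerProductSpace

noncomputable section

/-- A discrete-time linear time-invariant system `x_{t+1} = A x_t + u_t` in dimension `d`:
a rational transition matrix `A` and a set `U ⊆ ℝ^d` of controls `u_t`. -/
structure LTISystem (d : ℕ) where
  A : Matrix (Fin d) (Fin d) ℚ
  U : Set (EuclideanSpace ℝ (Fin d))

/-- A bounded convex polytope: the convex hull of finitely many points. -/
def IsConvexPolytope {d : ℕ} (S : Set (EuclideanSpace ℝ (Fin d))) : Prop :=
  ∃ s : Finset (EuclideanSpace ℝ (Fin d)), S = convexHull ℝ (s : Set (EuclideanSpace ℝ (Fin d)))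

/-- A vector of `ℝ^d` all of whose entries are algebraic numbers. -/
def IsAlgebraicVector {d : ℕ} (v : EuclideanSpace ℝ (Fin d)) : Prop :=
  ∀ i, IsAlgebraic ℚ (v i)

namespace LTISystem

variable {d : ℕ}

/-- The transition matrix with complex entries; its spectrum is the set of (complex) eigenvalues
of `A`. -/
def complexMatrix (L : LTISystem d) : Matrix (Fin d) (Fin d) ℂ :=
  L.A.map (algebraMap ℚ ℂ)

/-- The linear map `v ↦ A v` of `ℝ^d`. -/
def toEnd (L : LTISystem d) : Module.End ℝ (EuclideanSpace ℝ (Fin d)) :=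
  Matrix.toEuclideanLin (L.A.map (algebraMap ℚ ℝ))

/-- Simple LTI systems: the controls form a bounded convex polytope with `0` in its relative
interior, the spectral radius of `A` is less than one, and some positive power of `A` has
exclusively real spectrum. -/
structure IsSimple (L : LTISystem d) : Prop where
  polytope : IsConvexPolytope L.U
  zero_mem_relint : ∃ r : ℝ, 0 < r ∧
    Metric.ball (0 : EuclideanSpace ℝ (Fin d)) r ∩
      (Submodule.span ℝ L.U : Set (EuclideanSpace ℝ (Fin d))) ⊆ L.U
  spectralRadius_lt_one : spectralRadius ℂ L.complexMatrix < 1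
  power_real_spectrum : ∃ m : ℕ, 0 < m ∧ ∀ z ∈ spectrum ℂ (L.complexMatrix ^ m), z.im = 0

/-- All (complex) eigenvalues of `A` are real and strictly positive. -/
def HasPositiveSpectrum (L : LTISystem d) : Prop :=
  ∀ z ∈ spectrum ℂ L.complexMatrix, z.im = 0 ∧ 0 < z.re

/-- The set `A^*(U) = ⋃_m ∑_{i=0}^m A^i(U)` of the states reachable from the origin. -/
def reach (L : LTISystem d) : Set (EuclideanSpace ℝ (Fin d)) :=
  {x | ∃ (m : ℕ) (u : ℕ → EuclideanSpace ℝ (Fin d)), (∀ i, u i ∈ L.U) ∧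
    x = ∑ i ∈ Finset.range (m + 1), (L.toEnd ^ i) (u i)}

/-- The set `A^∞(U) = ∑_{i=0}^∞ A^i(U)`. -/
def reachInf (L : LTISystem d) : Set (EuclideanSpace ℝ (Fin d)) :=
  {x | ∃ u : ℕ → EuclideanSpace ℝ (Fin d), (∀ i, u i ∈ L.U) ∧
    HasSum (fun i => (L.toEnd ^ i) (u i)) x}

end LTISystem

section Convex

variable {d : ℕ}

/-- The cone of separators of `C` and `D`. -/
def sepCone (C D : Set (EuclideanSpace ℝ (Fin d))) : Set (EuclideanSpace ℝ (Fin d)) :=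
  {τ | ∀ u ∈ C, ∀ v ∈ D, ⟪u, τ⟫_ℝ ≤ ⟪v, τ⟫_ℝ}

/-- The points of `C` at which `⟨·, τ⟩` is maximal on `C`. -/
def maxFace (τ : EuclideanSpace ℝ (Fin d)) (C : Set (EuclideanSpace ℝ (Fin d))) :
    Set (EuclideanSpace ℝ (Fin d)) :=
  {v | v ∈ C ∧ ∀ w ∈ C, ⟪w, τ⟫_ℝ ≤ ⟪v, τ⟫_ℝ}

/-- The points of `C` at which `⟨·, τ⟩` is minimal on `C`. -/
def minFace (τ : EuclideanSpace ℝ (Fin d)) (C : Set (EuclideanSpace ℝ (Fin d))) :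
    Set (EuclideanSpace ℝ (Fin d)) :=
  {v | v ∈ C ∧ ∀ w ∈ C, ⟪v, τ⟫_ℝ ≤ ⟪w, τ⟫_ℝ}

/-- Extremal vectors of a cone: the nonzero elements that generate an extreme ray. -/
def IsExtremalVector (K : Set (EuclideanSpace ℝ (Fin d))) (τ : EuclideanSpace ℝ (Fin d)) : Prop :=
  τ ∈ K ∧ τ ≠ 0 ∧ ∀ x ∈ K, ∀ y ∈ K, x + y = τ →
    (∃ a : ℝ, 0 ≤ a ∧ x = a • τ) ∧ (∃ b : ℝ, 0 ≤ b ∧ y = b • τ)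

/-- `Aff₀(S)`: the linear combinations of elements of `S` with coefficients of sum zero. -/
def affZero (S : Set (EuclideanSpace ℝ (Fin d))) : Submodule ℝ (EuclideanSpace ℝ (Fin d)) where
  carrier := {x | ∃ (m : ℕ) (c : Fin m → ℝ) (u : Fin m → EuclideanSpace ℝ (Fin d)),
    (∀ i, u i ∈ S) ∧ ∑ i, c i = 0 ∧ x = ∑ i, c i • u i}
  zero_mem' := ⟨0, Fin.elim0, Fin.elim0, fun i => i.elim0, by simp, by simp⟩
  add_mem' := by
    rintro x y ⟨m, c, u, hu, hc, rfl⟩ ⟨n, b, v, hv, hb, rfl⟩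
    refine ⟨m + n, Fin.append c b, Fin.append u v, fun i => ?_, ?_, ?_⟩
    · refine Fin.addCases (fun i => ?_) (fun i => ?_) i
      · simpa using hu i
      · simpa using hv i
    · simp [Fin.sum_univ_add, hc, hb]
    · simp [Fin.sum_univ_add]
  smul_mem' := by
    rintro r x ⟨m, c, u, hu, hc, rfl⟩
    exact ⟨m, fun i => r * c i, u, hu, by rw [← Finset.mul_sum, hc, mul_zero],
      by simp [Finset.smul_sum, mul_smul]⟩

end Convex

section Forms

variable {d : ℕ}

theorem isCompl_ker_range_sub_pow (T : Module.End ℝ (EuclideanSpace ℝ (Fin d))) (μ : ℝ) :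
    IsCompl (LinearMap.ker ((T - μ • 1) ^ d)) (LinearMap.range ((T - μ • 1) ^ d)) := by
  have h := Module.End.generalized_eigenvec_disjoint_range_ker T μ
  rw [finrank_euclideanSpace_fin, Module.End.genEigenrange_nat, Module.End.genEigenspace_nat] at h
  refine (Submodule.isCompl_iff_disjoint _ _ ?_).2 h.symm
  rw [add_comm, LinearMap.finrank_range_add_finrank_ker]

/-- The spectral projection of `T` at `μ`: the projection onto the generalised eigenspace
`ker (T - μ)^d` along the `T`-invariant complement `range (T - μ)^d` (the sum of the other
generalised eigenspaces, if all eigenvalues are real). -/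
def spectralProj (T : Module.End ℝ (EuclideanSpace ℝ (Fin d))) (μ : ℝ) :
    Module.End ℝ (EuclideanSpace ℝ (Fin d)) :=
  Submodule.projection _ _ (isCompl_ker_range_sub_pow T μ)

/-- The bilinear forms `L_{μ,j}(u, τ) = μ^{-j} ⟨(T - μ)^j E_μ u, τ⟩`, where `E_μ` is the spectral
projection at `μ`. They are the coefficients of the functions `n ↦ (n choose j) μ^n` in
`⟨T^n u, τ⟩`, see `inner_pow_eq_sum_expForm`. -/
def expForm (T : Module.End ℝ (EuclideanSpace ℝ (Fin d))) (μ : ℝ) (j : ℕ) :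
    EuclideanSpace ℝ (Fin d) →ₗ[ℝ] EuclideanSpace ℝ (Fin d) →ₗ[ℝ] ℝ :=
  (μ ^ j)⁻¹ • (innerₗ (EuclideanSpace ℝ (Fin d)) ∘ₗ
    ((T - μ • 1) ^ j * spectralProj T μ))

theorem spectralProj_apply_of_mem (T : Module.End ℝ (EuclideanSpace ℝ (Fin d))) {μ : ℝ}
    {u : EuclideanSpace ℝ (Fin d)} (hu : u ∈ T.maxGenEigenspace μ) :
    spectralProj T μ u = u := by
  rw [Module.End.maxGenEigenspace_eq_genEigenspace_finrank, finrank_euclideanSpace_fin,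
    Module.End.genEigenspace_nat] at hu
  exact Submodule.projection_apply_of_mem_left _ hu

theorem spectralProj_apply_of_mem_ne (T : Module.End ℝ (EuclideanSpace ℝ (Fin d))) {μ ν : ℝ}
    (h : μ ≠ ν) {u : EuclideanSpace ℝ (Fin d)} (hu : u ∈ T.maxGenEigenspace ν) :
    spectralProj T μ u = 0 := by
  have hc : Commute T ((T - μ • 1) ^ d) :=
    ((Commute.refl T).sub_right ((Commute.one_right T).smul_right μ)).pow_right d
  have hm := Module.End.mapsTo_maxGenEigenspace_of_comm hc ν
  have hinj : Function.Injective (((T - μ • 1) ^ d).restrict hm) := by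
    rw [← LinearMap.ker_eq_bot, LinearMap.ker_eq_bot']
    rintro ⟨x, hx⟩ h0
    have h0' : ((T - μ • 1) ^ d) x = 0 := congrArg Subtype.val h0
    have hd := Module.End.disjoint_genEigenspace T h d ⊤
    rw [Module.End.genEigenspace_nat, Submodule.disjoint_def] at hd
    exact Subtype.ext (hd x h0' hx)
  obtain ⟨⟨y, hy⟩, hyu⟩ := (LinearMap.injective_iff_surjective.1 hinj) ⟨u, hu⟩
  have hyu' : ((T - μ • 1) ^ d) y = u := congrArg Subtype.val hyu
  rw [spectralProj, Submodule.projection_apply_eq_zero_iff]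
  exact ⟨y, hyu'⟩

theorem ker_aeval_prod_le (T : Module.End ℝ (EuclideanSpace ℝ (Fin d))) (m : ℝ → ℕ)
    (s : Finset ℝ) :
    LinearMap.ker (Polynomial.aeval T
      (∏ a ∈ s, (Polynomial.X - Polynomial.C a) ^ m a)) ≤ ⨆ μ, T.maxGenEigenspace μ := by
  induction s using Finset.induction_on with
  | empty => simp [Module.End.one_eq_id]
  | insert a s ha ih =>
    rw [Finset.prod_insert ha, ← Polynomial.sup_ker_aeval_eq_ker_aeval_mul_of_coprime]
    · refine sup_le (fun x hx => ?_) ih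
      refine Submodule.mem_iSup_of_mem a ((Module.End.mem_maxGenEigenspace T a x).2 ⟨m a, ?_⟩)
      simpa [Algebra.algebraMap_eq_smul_one] using hx
    · refine IsCoprime.prod_right fun b hb => IsCoprime.pow ?_
      exact Polynomial.isCoprime_X_sub_C_of_isUnit_sub
        (sub_ne_zero.2 (fun h : a = b => ha (h ▸ hb))).isUnit

theorem LTISystem.map_charpoly (L : LTISystem d) :
    L.toEnd.charpoly.map (algebraMap ℝ ℂ) = L.complexMatrix.charpoly := by
  have h : L.toEnd.charpoly = (L.A.map (algebraMap ℚ ℝ)).charpoly := by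
    rw [LTISystem.toEnd, Matrix.toEuclideanLin, Matrix.toLpLin_eq_toLin, Matrix.charpoly_toLin]
  rw [h, LTISystem.complexMatrix, ← Matrix.charpoly_map]
  congr 1

theorem LTISystem.splits_charpoly (L : LTISystem d) (hL : L.HasPositiveSpectrum) :
    L.toEnd.charpoly.Splits := by
  refine Polynomial.Splits.of_splits_map (algebraMap ℝ ℂ) (IsAlgClosed.splits _) ?_
  intro z hz
  rw [L.map_charpoly, Polynomial.mem_roots (Matrix.charpoly_monic _).ne_zero,
    ← Matrix.mem_spectrum_iff_isRoot_charpoly] at hz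
  exact ⟨z.re, Complex.ext (by simp) (by simp [(hL z hz).1])⟩

theorem LTISystem.pos_of_isRoot (L : LTISystem d) (hL : L.HasPositiveSpectrum) {μ : ℝ}
    (hμ : L.toEnd.charpoly.IsRoot μ) : 0 < μ := by
  have h : (μ : ℂ) ∈ spectrum ℂ L.complexMatrix := by
    rw [Matrix.mem_spectrum_iff_isRoot_charpoly, ← L.map_charpoly]
    exact hμ.map (f := algebraMap ℝ ℂ)
  simpa using (hL _ h).2

theorem LTISystem.iSup_maxGenEigenspace (L : LTISystem d) (hL : L.HasPositiveSpectrum) :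
    ⨆ μ, L.toEnd.maxGenEigenspace μ = ⊤ := by
  rw [eq_top_iff]
  refine le_trans ?_ (ker_aeval_prod_le L.toEnd (fun a => L.toEnd.charpoly.roots.count a)
    L.toEnd.charpoly.roots.toFinset)
  have h : L.toEnd.charpoly = ∏ a ∈ L.toEnd.charpoly.roots.toFinset,
      (Polynomial.X - Polynomial.C a) ^ L.toEnd.charpoly.roots.count a := by
    conv_lhs => rw [(L.splits_charpoly hL).eq_prod_roots, L.toEnd.charpoly_monic.leadingCoeff]
    simp [Finset.prod_multiset_map_count]
  rw [← h, LinearMap.aeval_self_charpoly]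
  simp

theorem pow_apply_eq_sum (T : Module.End ℝ (EuclideanSpace ℝ (Fin d))) {μ : ℝ} (hμ : μ ≠ 0)
    {u : EuclideanSpace ℝ (Fin d)} (hu : ((T - μ • 1) ^ d) u = 0) (n : ℕ) :
    (T ^ n) u = ∑ j ∈ Finset.range d,
      ((n.choose j : ℝ) * μ ^ n * (μ ^ j)⁻¹) • ((T - μ • 1) ^ j) u := by
  have hz : ∀ j, d ≤ j → ((T - μ • 1) ^ j) u = 0 := by
    intro j hj
    obtain ⟨k, rfl⟩ := Nat.exists_eq_add_of_le hj
    rw [add_comm, pow_add, Module.End.mul_apply, hu, map_zero]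
  have hT : T = (T - μ • 1) + μ • 1 := by simp
  have hcomm : Commute (T - μ • 1) (μ • (1 : Module.End ℝ (EuclideanSpace ℝ (Fin d)))) :=
    (Commute.one_right _).smul_right μ
  have h1 : (T ^ n) u = ∑ j ∈ Finset.range (n + 1),
      ((n.choose j : ℝ) * μ ^ n * (μ ^ j)⁻¹) • ((T - μ • 1) ^ j) u := by
    conv_lhs => rw [hT, hcomm.add_pow]
    rw [LinearMap.sum_apply]
    refine Finset.sum_congr rfl fun j hj => ?_
    have hjn : j ≤ n := Nat.lt_succ_iff.1 (Finset.mem_range.1 hj)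
    rw [smul_pow, one_pow, mul_smul_comm, mul_one, ← Nat.cast_comm, ← nsmul_eq_mul]
    rw [pow_sub₀ μ hμ hjn, LinearMap.smul_apply, LinearMap.smul_apply, ← Nat.cast_smul_eq_nsmul ℝ,
      smul_smul, mul_assoc]
  rw [h1]
  have hA : ∀ N, d ≤ N → n + 1 ≤ N → ∑ j ∈ Finset.range (n + 1),
      ((n.choose j : ℝ) * μ ^ n * (μ ^ j)⁻¹) • ((T - μ • 1) ^ j) u = ∑ j ∈ Finset.range d,
      ((n.choose j : ℝ) * μ ^ n * (μ ^ j)⁻¹) • ((T - μ • 1) ^ j) u := by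
    intro N h1 h2
    rw [Finset.sum_subset (Finset.range_subset_range.2 h2),
      Finset.sum_subset (Finset.range_subset_range.2 h1)]
    · intro j _ hj
      rw [hz j (by simpa using hj), smul_zero]
    · intro j _ hj
      rw [Nat.choose_eq_zero_of_lt (by simpa using hj)]
      simp
  exact hA (max d (n + 1)) (le_max_left _ _) (le_max_right _ _)

/-- The expansion that characterises the forms `expForm`. -/
theorem LTISystem.inner_pow_eq_sum_expForm (L : LTISystem d) (hL : L.HasPositiveSpectrum)
    (u τ : EuclideanSpace ℝ (Fin d)) (n : ℕ) :
    ⟪(L.toEnd ^ n) u, τ⟫_ℝ =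
      ∑ μ ∈ L.toEnd.charpoly.roots.toFinset, ∑ j ∈ Finset.range d,
        (n.choose j : ℝ) * μ ^ n * expForm L.toEnd μ j u τ := by
  have hu : u ∈ ⨆ μ, L.toEnd.maxGenEigenspace μ := by
    rw [L.iSup_maxGenEigenspace hL]
    exact Submodule.mem_top
  induction hu using Submodule.iSup_induction' with
  | zero => simp
  | add x y _ _ hx hy =>
    simp only [map_add, inner_add_left, LinearMap.add_apply, mul_add, Finset.sum_add_distrib,
      hx, hy]
  | mem ν x hx =>
    by_cases hν : L.toEnd.charpoly.IsRoot ν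
    · have hmem : ν ∈ L.toEnd.charpoly.roots.toFinset := by
        rw [Multiset.mem_toFinset, Polynomial.mem_roots L.toEnd.charpoly_monic.ne_zero]
        exact hν
      rw [Finset.sum_eq_single_of_mem ν hmem]
      · have hx' := hx
        rw [Module.End.maxGenEigenspace_eq_genEigenspace_finrank, finrank_euclideanSpace_fin,
          Module.End.genEigenspace_nat] at hx'
        rw [pow_apply_eq_sum L.toEnd (L.pos_of_isRoot hL hν).ne' hx', sum_inner]
        refine Finset.sum_congr rfl fun j _ => ?_
        simp [expForm, spectralProj_apply_of_mem L.toEnd hx, inner_smul_left, mul_assoc]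
      · intro μ _ hne
        refine Finset.sum_eq_zero fun j _ => ?_
        simp [expForm, spectralProj_apply_of_mem_ne L.toEnd hne hx]
    · have hbot : L.toEnd.maxGenEigenspace ν = ⊥ := by
        by_contra hne
        apply hν
        rw [← Module.End.hasEigenvalue_iff_isRoot_charpoly]
        rw [Module.End.maxGenEigenspace_eq_genEigenspace_finrank] at hne
        exact Module.End.hasEigenvalue_of_hasGenEigenvalue hne
      have hx0 : x = 0 := by simpa [hbot] using hx
      simp [hx0]

end Forms

namespace LTISystem

variable {d : ℕ}

/-- The subspace `Dom_L(τ)` of all `τ'` such that, for all vertices `u, u'` of `U` and all forms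
`L_{μ,j}` (`μ` an eigenvalue of `A`, `j < d`), `L_{μ,j}(u - u', τ) = 0` implies
`L_{μ,j}(u - u', τ') = 0`. -/
def dom (L : LTISystem d) (τ : EuclideanSpace ℝ (Fin d)) :
    Submodule ℝ (EuclideanSpace ℝ (Fin d)) where
  carrier := {τ' | ∀ u ∈ L.U.extremePoints ℝ, ∀ u' ∈ L.U.extremePoints ℝ,
    ∀ μ : ℝ, L.toEnd.HasEigenvalue μ → ∀ j < d,
      expForm L.toEnd μ j (u - u') τ = 0 → expForm L.toEnd μ j (u - u') τ' = 0}
  zero_mem' := by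
    intro u _ u' _ μ _ j _ _
    exact map_zero _
  add_mem' := by
    intro x y hx hy u hu u' hu' μ hμ j hj h
    rw [map_add, hx u hu u' hu' μ hμ j hj h, hy u hu u' hu' μ hμ j hj h, add_zero]
  smul_mem' := by
    intro c x hx u hu u' hu' μ hμ j hj h
    rw [map_smul, hx u hu u' hu' μ hμ j hj h, smul_zero]

end LTISystem

end

noncomputable section

open Filter Asymptotics

theorem isLittleO_choose_mul_pow_of_lt {μ ν : ℝ} (hμ : 0 < μ) (h : μ < ν) (j k : ℕ) :
    (fun n : ℕ => (n.choose j : ℝ) * μ ^ n) =o[atTop] fun n : ℕ => (n.choose k : ℝ) * ν ^ n := by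
  have h1 : (fun n : ℕ => (n.choose j : ℝ) * μ ^ n) =O[atTop] fun n : ℕ => (n : ℝ) ^ j * μ ^ n :=
    (isTheta_choose j).1.mul (isBigO_refl _ _)
  have h2 : (fun n : ℕ => (n : ℝ) ^ j * μ ^ n) =o[atTop] fun n : ℕ => ν ^ n :=
    isLittleO_pow_const_mul_const_pow_const_pow_of_norm_lt j
      (by rwa [Real.norm_of_nonneg hμ.le])
  refine (h1.trans_isLittleO h2).trans_isBigO (IsBigO.of_bound 1 ?_)
  filter_upwards [eventually_ge_atTop k] with n hn
  have hν : 0 ≤ ν ^ n := pow_nonneg (hμ.le.trans h.le) n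
  have hc : (1 : ℝ) ≤ n.choose k := by exact_mod_cast Nat.choose_pos hn
  rw [one_mul, norm_mul, Real.norm_of_nonneg (by positivity : (0 : ℝ) ≤ n.choose k)]
  exact le_mul_of_one_le_left (norm_nonneg _) hc

theorem isLittleO_choose_mul_pow_of_lt' (μ : ℝ) {j k : ℕ} (h : j < k) :
    (fun n : ℕ => (n.choose j : ℝ) * μ ^ n) =o[atTop] fun n : ℕ => (n.choose k : ℝ) * μ ^ n := by
  have h1 : (fun n : ℕ => (n : ℝ) ^ j) =o[atTop] fun n : ℕ => (n : ℝ) ^ k :=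
    (isLittleO_pow_pow_atTop_of_lt h).comp_tendsto tendsto_natCast_atTop_atTop
  exact (((isTheta_choose j).1.trans_isLittleO h1).trans_isBigO (isTheta_choose k).2).mul_isBigO
    (isBigO_refl _ _)

/-- A nontrivial linear combination of functions of pairwise different growth is dominated by one
of its terms. -/
theorem exists_isEquivalent_sum {ι : Type*} [LinearOrder ι] {I : Finset ι} {φ : ι → ℕ → ℝ}
    (hφ : ∀ p ∈ I, ∀ q ∈ I, p < q → φ p =o[atTop] φ q) {a : ι → ℝ} (ha : ∃ p ∈ I, a p ≠ 0) :
    ∃ p ∈ I, a p ≠ 0 ∧ (fun n => ∑ q ∈ I, φ q n * a q) ~[atTop] (fun n => φ p n * a p) ∧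
      ∀ b : ι → ℝ, (∀ q ∈ I, a q = 0 → b q = 0) →
        (fun n => ∑ q ∈ I, φ q n * b q) =O[atTop] (fun n => φ p n * a p) := by
  classical
  have hne : (I.filter fun p => a p ≠ 0).Nonempty := by
    obtain ⟨p, hp, h⟩ := ha
    exact ⟨p, by simp [hp, h]⟩
  obtain ⟨hpI, hp0⟩ := Finset.mem_filter.1 (Finset.max'_mem _ hne)
  have hle : ∀ q ∈ I.filter (fun p => a p ≠ 0), q ≤ (I.filter fun p => a p ≠ 0).max' hne :=
    fun q hq => Finset.le_max' _ q hq
  generalize (I.filter fun p => a p ≠ 0).max' hne = p at hpI hp0 hle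
  have key : ∀ b : ι → ℝ, (∀ q ∈ I, a q = 0 → b q = 0) → ∀ q ∈ I, q ≠ p →
      (fun n => φ q n * b q) =o[atTop] (fun n => φ p n * a p) := by
    intro b hb q hq hqp
    by_cases h0 : a q = 0
    · simp [hb q hq h0]
    · have hlt : q < p := lt_of_le_of_ne (hle q (by simp [hq, h0])) hqp
      simp_rw [mul_comm _ (b q), mul_comm _ (a p)]
      exact ((hφ q hq p hpI hlt).const_mul_left _).const_mul_right hp0
  refine ⟨p, hpI, hp0, ?_, fun b hb => IsBigO.fun_sum fun q hq => ?_⟩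
  · have hs : ((fun n => ∑ q ∈ I, φ q n * a q) - fun n => φ p n * a p) =
        fun n => ∑ q ∈ I.erase p, φ q n * a q := by
      funext n
      simp [← Finset.add_sum_erase I _ hpI]
    rw [IsEquivalent, hs]
    exact IsLittleO.fun_sum fun q hq => key a (fun _ _ h => h) q (Finset.mem_of_mem_erase hq)
      (Finset.ne_of_mem_erase hq)
  · by_cases hqp : q = p
    · subst hqp
      simp_rw [mul_comm (φ q _)]
      exact ((isBigO_refl _ _).const_mul_left _).const_mul_right hp0
    · exact (key b hb q hq hqp).isBigO

namespace LTISystem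

variable {d : ℕ}

/-- The index set of the expansion of `⟨A^n u, τ⟩`, ordered by growth. -/
def expIndex (L : LTISystem d) : Finset (ℝ ×ₗ ℕ) :=
  (L.toEnd.charpoly.roots.toFinset ×ˢ Finset.range d).map toLex.toEmbedding

theorem mem_expIndex (L : LTISystem d) {p : ℝ ×ₗ ℕ} :
    p ∈ L.expIndex ↔ L.toEnd.HasEigenvalue (ofLex p).1 ∧ (ofLex p).2 < d := by
  rw [Module.End.hasEigenvalue_iff_isRoot_charpoly]
  simp [expIndex, L.toEnd.charpoly_monic.ne_zero]

theorem inner_pow_eq_sum_expIndex (L : LTISystem d) (hL : L.HasPositiveSpectrum)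
    (u τ : EuclideanSpace ℝ (Fin d)) (n : ℕ) :
    ⟪(L.toEnd ^ n) u, τ⟫_ℝ = ∑ p ∈ L.expIndex,
      ((n.choose (ofLex p).2 : ℝ) * (ofLex p).1 ^ n) *
        expForm L.toEnd (ofLex p).1 (ofLex p).2 u τ := by
  rw [L.inner_pow_eq_sum_expForm hL, expIndex, Finset.sum_map, Finset.sum_product]
  rfl

theorem pos_of_hasEigenvalue (L : LTISystem d) (hL : L.HasPositiveSpectrum) {μ : ℝ}
    (hμ : L.toEnd.HasEigenvalue μ) : 0 < μ :=
  L.pos_of_isRoot hL ((Module.End.hasEigenvalue_iff_isRoot_charpoly _ _).1 hμ)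

theorem isLittleO_of_mem_expIndex (L : LTISystem d) (hL : L.HasPositiveSpectrum)
    (p : ℝ ×ₗ ℕ) (hp : p ∈ L.expIndex) (q : ℝ ×ₗ ℕ) (h : p < q) :
    (fun n : ℕ => (n.choose (ofLex p).2 : ℝ) * (ofLex p).1 ^ n) =o[atTop]
      fun n : ℕ => (n.choose (ofLex q).2 : ℝ) * (ofLex q).1 ^ n := by
  have hpos := L.pos_of_hasEigenvalue hL (L.mem_expIndex.1 hp).1
  rcases Prod.Lex.lt_iff.1 h with h | ⟨h, h'⟩
  · exact isLittleO_choose_mul_pow_of_lt hpos h _ _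
  · rw [← h]
    exact isLittleO_choose_mul_pow_of_lt' _ h'

theorem isBigO_inner_pow (L : LTISystem d) (hL : L.HasPositiveSpectrum)
    {y τ τ' : EuclideanSpace ℝ (Fin d)}
    (h : ∀ μ : ℝ, L.toEnd.HasEigenvalue μ → ∀ j < d,
      expForm L.toEnd μ j y τ = 0 → expForm L.toEnd μ j y τ' = 0) :
    (fun n => ⟪(L.toEnd ^ n) y, τ'⟫_ℝ) =O[atTop] fun n => ⟪(L.toEnd ^ n) y, τ⟫_ℝ := by
  simp_rw [L.inner_pow_eq_sum_expIndex hL]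
  have h' : ∀ q ∈ L.expIndex, expForm L.toEnd (ofLex q).1 (ofLex q).2 y τ = 0 →
      expForm L.toEnd (ofLex q).1 (ofLex q).2 y τ' = 0 := fun q hq =>
    h _ (L.mem_expIndex.1 hq).1 _ (L.mem_expIndex.1 hq).2
  by_cases ha : ∃ p ∈ L.expIndex, expForm L.toEnd (ofLex p).1 (ofLex p).2 y τ ≠ 0
  · obtain ⟨p, -, -, he, hb⟩ := exists_isEquivalent_sum
      (fun p hp q _ hpq => L.isLittleO_of_mem_expIndex hL p hp q hpq) ha
    exact (hb _ h').trans he.isBigO_symm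
  · push Not at ha
    refine IsBigO.of_bound 1 (Eventually.of_forall fun n => ?_)
    rw [Finset.sum_eq_zero fun p hp => by rw [h' p hp (ha p hp), mul_zero], norm_zero]
    positivity

theorem eventually_sign_inner_pow (L : LTISystem d) (hL : L.HasPositiveSpectrum)
    (y τ : EuclideanSpace ℝ (Fin d)) :
    (∀ᶠ n in atTop, 0 ≤ ⟪(L.toEnd ^ n) y, τ⟫_ℝ) ∨ (∀ᶠ n in atTop, ⟪(L.toEnd ^ n) y, τ⟫_ℝ < 0) := by
  simp_rw [L.inner_pow_eq_sum_expIndex hL]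
  by_cases ha : ∃ p ∈ L.expIndex, expForm L.toEnd (ofLex p).1 (ofLex p).2 y τ ≠ 0
  · obtain ⟨p, hp, hp0, he, -⟩ := exists_isEquivalent_sum
      (fun p hp q _ hpq => L.isLittleO_of_mem_expIndex hL p hp q hpq) ha
    have hpos := L.pos_of_hasEigenvalue hL (L.mem_expIndex.1 hp).1
    have hφ : ∀ᶠ n : ℕ in atTop, 0 < (n.choose (ofLex p).2 : ℝ) * (ofLex p).1 ^ n := by
      filter_upwards [eventually_ge_atTop (ofLex p).2] with n hn
      have : 0 < n.choose (ofLex p).2 := Nat.choose_pos hn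
      positivity
    rcases hp0.lt_or_gt with h | h
    · exact Or.inr (he.eventually_neg (hφ.mono fun n hn => mul_neg_of_pos_of_neg hn h))
    · exact Or.inl (he.eventually_nonneg (hφ.mono fun n hn => (mul_pos hn h).le))
  · push Not at ha
    left
    refine Eventually.of_forall fun n => (Finset.sum_eq_zero fun p hp => ?_).ge
    rw [ha p hp, mul_zero]

theorem lt_one_of_hasEigenvalue (L : LTISystem d) (hL : L.IsSimple) {μ : ℝ} (h0 : 0 < μ)
    (hμ : L.toEnd.HasEigenvalue μ) : μ < 1 := by
  have h : (μ : ℂ) ∈ spectrum ℂ L.complexMatrix := by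
    rw [Matrix.mem_spectrum_iff_isRoot_charpoly, ← L.map_charpoly]
    exact ((Module.End.hasEigenvalue_iff_isRoot_charpoly _ _).1 hμ).map (f := algebraMap ℝ ℂ)
  have h1 : ((‖(μ : ℂ)‖₊ : ENNReal)) < 1 :=
    lt_of_le_of_lt (le_iSup₂_of_le (f := fun k (_ : k ∈ spectrum ℂ L.complexMatrix) =>
      ((‖k‖₊ : ENNReal))) _ h le_rfl) hL.spectralRadius_lt_one
  have h2 : ‖(μ : ℂ)‖ < 1 := by exact_mod_cast h1
  rwa [Complex.norm_real, Real.norm_of_nonneg h0.le] at h2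

theorem summable_inner_pow (L : LTISystem d) (hL : L.IsSimple) (hpos : L.HasPositiveSpectrum)
    (y τ : EuclideanSpace ℝ (Fin d)) : Summable fun n => ⟪(L.toEnd ^ n) y, τ⟫_ℝ := by
  simp_rw [L.inner_pow_eq_sum_expIndex hpos]
  refine summable_sum fun p hp => Summable.mul_right _ ?_
  have h0 := L.pos_of_hasEigenvalue hpos (L.mem_expIndex.1 hp).1
  refine Summable.of_nonneg_of_le (fun n => by positivity) (fun n => ?_)
    (summable_choose_mul_geometric_of_norm_lt_one (R := ℝ) (ofLex p).2 (r := (ofLex p).1) (by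
      rw [Real.norm_of_nonneg h0.le]
      exact L.lt_one_of_hasEigenvalue hL h0 (L.mem_expIndex.1 hp).1))
  gcongr
  exact Nat.le_add_right _ _

theorem exists_summable_norm_pow_le (L : LTISystem d) (hL : L.IsSimple)
    (hpos : L.HasPositiveSpectrum) :
    ∃ b : ℕ → ℝ, Summable b ∧ ∀ n y, ‖(L.toEnd ^ n) y‖ ≤ b n * ‖y‖ := by
  have hs : ∀ y, Summable fun n => ‖(L.toEnd ^ n) y‖ := by
    intro y
    rw [summable_norm_iff]
    have h : (fun n => (L.toEnd ^ n) y) = fun n => ∑ k,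
        ⟪(L.toEnd ^ n) y, EuclideanSpace.basisFun (Fin d) ℝ k⟫_ℝ •
          EuclideanSpace.basisFun (Fin d) ℝ k := by
      funext n
      conv_lhs => rw [← (EuclideanSpace.basisFun (Fin d) ℝ).sum_repr' ((L.toEnd ^ n) y)]
      simp_rw [real_inner_comm]
    rw [h]
    exact summable_sum fun k _ => (L.summable_inner_pow hL hpos y _).smul_const _
  refine ⟨fun n => ∑ k, ‖(L.toEnd ^ n) (EuclideanSpace.basisFun (Fin d) ℝ k)‖,
    summable_sum fun k _ => hs _, fun n y => ?_⟩
  conv_lhs => rw [← (EuclideanSpace.basisFun (Fin d) ℝ).sum_repr' y, map_sum]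
  rw [Finset.sum_mul]
  refine (norm_sum_le _ _).trans (Finset.sum_le_sum fun k _ => ?_)
  rw [map_smul, norm_smul, mul_comm]
  refine mul_le_mul_of_nonneg_left ((norm_inner_le_norm _ _).trans ?_) (norm_nonneg _)
  simp

end LTISystem

namespace IsConvexPolytope

variable {d : ℕ} {S : Set (EuclideanSpace ℝ (Fin d))}

theorem isCompact (h : IsConvexPolytope S) : IsCompact S := by
  obtain ⟨s, rfl⟩ := h
  exact s.finite_toSet.isCompact_convexHull ℝ

theorem finite_extremePoints (h : IsConvexPolytope S) : (S.extremePoints ℝ).Finite := by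
  obtain ⟨s, rfl⟩ := h
  exact s.finite_toSet.subset extremePoints_convexHull_subset

theorem convexHull_extremePoints (h : IsConvexPolytope S) :
    convexHull ℝ (S.extremePoints ℝ) = S := by
  have hc : Convex ℝ S := by
    obtain ⟨s, rfl⟩ := h
    exact convex_convexHull ℝ _
  rw [← (h.finite_extremePoints.isClosed_convexHull ℝ).closure_eq]
  exact closure_convexHull_extremePoints h.isCompact hc

end IsConvexPolytope

section

variable {E : Type*} [AddCommGroup E] [Module ℝ E] {V : Set E} {f g : E →ₗ[ℝ] ℝ} {w : E} {M : ℝ}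

theorem le_of_mem_convexHull_of_forall_le (h : ∀ v ∈ V, f v ≤ f w) :
    ∀ v ∈ convexHull ℝ V, f v ≤ f w := by
  intro v hv
  exact convexHull_min h (convex_halfSpace_le f.isLinear (f w)) hv

theorem abs_le_of_mem_convexHull (h : ∀ v ∈ V, |g (w - v)| ≤ M * f (w - v)) :
    ∀ v ∈ convexHull ℝ V, |g (w - v)| ≤ M * f (w - v) := by
  have key : ∀ c : ℝ, |c| = 1 → ∀ v ∈ convexHull ℝ V, c * g (w - v) ≤ M * f (w - v) := by
    intro c hc v hv
    have h1 : (M • f - c • g) v ≤ (M • f - c • g) w := by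
      refine le_of_mem_convexHull_of_forall_le (fun u hu => ?_) v hv
      have h2 : c * g (w - u) ≤ |g (w - u)| := by
        calc c * g (w - u) ≤ |c * g (w - u)| := le_abs_self _
          _ = _ := by rw [abs_mul, hc, one_mul]
      have h3 := h2.trans (h u hu)
      simp only [map_sub, LinearMap.sub_apply, LinearMap.smul_apply, smul_eq_mul] at h3 ⊢
      linarith
    simp only [map_sub, LinearMap.sub_apply, LinearMap.smul_apply, smul_eq_mul] at h1 ⊢
    linarith
  intro v hv
  have h1 := key 1 (by simp) v hv
  have h2 := key (-1) (by simp) v hv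
  exact abs_le.2 ⟨by linarith, by linarith⟩

/-- On a finite set of points, a functional that is constant where `f` is maximal varies at most
proportionally to `f` around a maximiser of `f`. -/
theorem exists_abs_le_of_finite (hV : V.Finite) (hf : ∀ v ∈ V, f v ≤ f w)
    (hg : ∀ v ∈ V, f v = f w → g v = g w) :
    ∃ M : ℝ, 0 ≤ M ∧ ∀ v ∈ V, |g (w - v)| ≤ M * f (w - v) := by
  obtain ⟨M, hM⟩ := (hV.image fun v => |g (w - v)| / f (w - v)).bddAbove
  refine ⟨max M 0, le_max_right _ _, fun v hv => ?_⟩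
  rcases (hf v hv).eq_or_lt with h | h
  · simp [h, hg v hv h]
  · have h' : 0 < f (w - v) := by
      rw [map_sub]
      linarith
    have h1 := hM (Set.mem_image_of_mem _ hv)
    rw [div_le_iff₀ h'] at h1
    exact h1.trans (mul_le_mul_of_nonneg_right (le_max_left _ _) h'.le)

end

theorem exists_eventually_max {ι : Type*} {V : Set ι} (hV : V.Finite) (hne : V.Nonempty)
    (f : ι → ℕ → ℝ) (hf : ∀ u v, (∀ᶠ n in atTop, f v n ≤ f u n) ∨ ∀ᶠ n in atTop, f u n < f v n) :
    ∃ w : ℕ → ι, (∀ n, w n ∈ V ∧ ∀ v ∈ V, f v n ≤ f (w n) n) ∧ ∃ N, ∀ n ≥ N, w n = w N := by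
  classical
  have hmax : ∀ n, ∃ w ∈ V, ∀ v ∈ V, f v n ≤ f w n := fun n =>
    Set.exists_max_image V (fun v => f v n) hV hne
  choose w₀ hw₀ hmax using hmax
  obtain ⟨u, hu, hfreq⟩ : ∃ u ∈ V, ∃ᶠ n in atTop, w₀ n = u := by
    by_contra! h
    have h1 : ∀ᶠ n in atTop, ∀ u ∈ V, w₀ n ≠ u :=
      (hV.eventually_all).2 fun u hu => by simpa using h u hu
    obtain ⟨n, hn⟩ := h1.exists
    exact hn _ (hw₀ n) rfl
  have hev : ∀ᶠ n in atTop, ∀ v ∈ V, f v n ≤ f u n := by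
    refine (hV.eventually_all).2 fun v hv => (hf u v).resolve_right fun h => ?_
    obtain ⟨n, hn, hlt⟩ := (hfreq.and_eventually h).exists
    exact absurd (hn ▸ hmax n v hv) (not_le.2 hlt)
  obtain ⟨N, hN⟩ := eventually_atTop.1 hev
  refine ⟨fun n => if N ≤ n then u else w₀ n, fun n => ?_, N, fun n hn => by simp [hn.le]⟩
  by_cases h : N ≤ n
  · simpa [h, hu] using hN n h
  · simpa [h, hw₀ n] using hmax n

variable {d : ℕ}

theorem IsAlgebraicVector.sub {x y : EuclideanSpace ℝ (Fin d)} (hx : IsAlgebraicVector x)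
    (hy : IsAlgebraicVector y) : IsAlgebraicVector (x - y) :=
  fun i => (hx i).sub (hy i)

/-- The vectors with algebraic coordinates, as a vector space over the real algebraic numbers. -/
def algebraicVectors (d : ℕ) :
    Submodule (algebraicClosure ℚ ℝ) (EuclideanSpace ℝ (Fin d)) where
  carrier := {x | IsAlgebraicVector x}
  zero_mem' := fun _ => isAlgebraic_zero
  add_mem' := fun hx hy i => (hx i).add (hy i)
  smul_mem' := fun c _ hx i => (mem_algebraicClosure_iff.1 c.2).mul (hx i)

instance : FiniteDimensional (algebraicClosure ℚ ℝ) (algebraicVectors d) := by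
  let f : algebraicVectors d →ₗ[algebraicClosure ℚ ℝ] (Fin d → algebraicClosure ℚ ℝ) :=
    { toFun := fun x i => ⟨x.1 i, mem_algebraicClosure_iff.2 (x.2 i)⟩
      map_add' := fun _ _ => rfl
      map_smul' := fun _ _ => rfl }
  refine FiniteDimensional.of_injective f fun x y h => Subtype.ext (PiLp.ext fun i => ?_)
  exact congrArg Subtype.val (congrFun h i)

/-- An endomorphism preserving algebraic vectors, restricted to them. -/
def algebraicRestrict (S : Module.End ℝ (EuclideanSpace ℝ (Fin d)))
    (hS : ∀ x, IsAlgebraicVector x → IsAlgebraicVector (S x)) :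
    Module.End (algebraicClosure ℚ ℝ) (algebraicVectors d) where
  toFun := fun x => ⟨S x.1, hS _ x.2⟩
  map_add' := fun x y => Subtype.ext (map_add S x.1 y.1)
  map_smul' := fun c x => Subtype.ext (map_smul S (c : ℝ) x.1)

theorem IsAlgebraicVector.of_apply {S : Module.End ℝ (EuclideanSpace ℝ (Fin d))}
    (hS : ∀ x, IsAlgebraicVector x → IsAlgebraicVector (S x)) (hinj : Function.Injective S)
    {x : EuclideanSpace ℝ (Fin d)} (hx : IsAlgebraicVector (S x)) : IsAlgebraicVector x := by
  have h : Function.Injective (algebraicRestrict S hS) := fun x y h =>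
    Subtype.ext (hinj (congrArg Subtype.val h))
  obtain ⟨y, hy⟩ := LinearMap.injective_iff_surjective.1 h ⟨S x, hx⟩
  have hyx : y.1 = x := hinj (congrArg Subtype.val hy)
  exact hyx ▸ y.2

theorem IsAlgebraicVector.exists_add_apply {S : Module.End ℝ (EuclideanSpace ℝ (Fin d))}
    (hS : ∀ x, IsAlgebraicVector x → IsAlgebraicVector (S x))
    (hd : Disjoint (LinearMap.ker S) (LinearMap.range S))
    {x : EuclideanSpace ℝ (Fin d)} (hx : IsAlgebraicVector x) :
    ∃ y z, IsAlgebraicVector y ∧ S y = 0 ∧ x = y + S z := by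
  have h : Disjoint (LinearMap.ker (algebraicRestrict S hS))
      (LinearMap.range (algebraicRestrict S hS)) := by
    rw [Submodule.disjoint_def] at hd ⊢
    rintro _ hy ⟨z, rfl⟩
    exact Subtype.ext (hd _ (congrArg Subtype.val (LinearMap.mem_ker.1 hy)) ⟨z.1, rfl⟩)
  have hc : IsCompl (LinearMap.ker (algebraicRestrict S hS))
      (LinearMap.range (algebraicRestrict S hS)) := by
    refine (Submodule.isCompl_iff_disjoint _ _ ?_).2 h
    rw [add_comm, LinearMap.finrank_range_add_finrank_ker]
  have hmem : (⟨x, hx⟩ : algebraicVectors d) ∈ LinearMap.ker (algebraicRestrict S hS) ⊔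
      LinearMap.range (algebraicRestrict S hS) := by
    rw [hc.sup_eq_top]
    exact Submodule.mem_top
  obtain ⟨y, hy, _, ⟨z, rfl⟩, h⟩ := Submodule.mem_sup.1 hmem
  exact ⟨y.1, z.1, y.2, congrArg Subtype.val (LinearMap.mem_ker.1 hy),
    (congrArg Subtype.val h).symm⟩

theorem IsAlgebraicVector.spectralProj {T : Module.End ℝ (EuclideanSpace ℝ (Fin d))} {μ : ℝ}
    (hT : ∀ x, IsAlgebraicVector x → IsAlgebraicVector (((T - μ • 1) ^ d) x))
    {x : EuclideanSpace ℝ (Fin d)} (hx : IsAlgebraicVector x) :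
    IsAlgebraicVector (spectralProj T μ x) := by
  obtain ⟨y, z, hy, hy0, rfl⟩ := hx.exists_add_apply hT (isCompl_ker_range_sub_pow T μ).disjoint
  have h1 : _root_.spectralProj T μ y = y := Submodule.projection_apply_of_mem_left _ hy0
  have h2 : _root_.spectralProj T μ (((T - μ • 1) ^ d) z) = 0 := by
    rw [_root_.spectralProj, Submodule.projection_apply_eq_zero_iff]
    exact ⟨z, rfl⟩
  rwa [map_add, h1, h2, add_zero]

theorem IsAlgebraicVector.pow_apply {T : Module.End ℝ (EuclideanSpace ℝ (Fin d))}
    (hT : ∀ x, IsAlgebraicVector x → IsAlgebraicVector (T x)) (n : ℕ)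
    {x : EuclideanSpace ℝ (Fin d)} (hx : IsAlgebraicVector x) :
    IsAlgebraicVector ((T ^ n) x) := by
  induction n with
  | zero => simpa using hx
  | succ n ih =>
    rw [pow_succ', Module.End.mul_apply]
    exact hT _ ih

/-- A system of linear equations in `ℝ^d` is equivalent to a finite subsystem. -/
theorem exists_finset_inner_eq_zero_iff (G : Set (EuclideanSpace ℝ (Fin d))) :
    ∃ F : Finset (EuclideanSpace ℝ (Fin d)), (F : Set (EuclideanSpace ℝ (Fin d))) ⊆ G ∧
      ∀ x, (∀ a ∈ F, ⟪a, x⟫_ℝ = 0) ↔ ∀ a ∈ G, ⟪a, x⟫_ℝ = 0 := by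
  obtain ⟨F, hFG, -, hF, -⟩ := Submodule.exists_finset_span_eq_linearIndepOn ℝ G
  refine ⟨F, hFG, fun x => ⟨fun h a ha => ?_, fun h a ha => h a (hFG ha)⟩⟩
  have hle : Submodule.span ℝ (F : Set (EuclideanSpace ℝ (Fin d))) ≤
      LinearMap.ker (innerₗ (EuclideanSpace ℝ (Fin d)) x) :=
    Submodule.span_le.2 fun a ha => by simpa [real_inner_comm] using h a ha
  have := hle (hF ▸ Submodule.subset_span ha)
  simpa [real_inner_comm] using this

namespace LTISystem

theorem isAlgebraicVector_toEnd (L : LTISystem d) {x : EuclideanSpace ℝ (Fin d)}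
    (hx : IsAlgebraicVector x) : IsAlgebraicVector (L.toEnd x) := by
  intro i
  have h : L.toEnd x i = ∑ j, (algebraMap ℚ ℝ (L.A i j)) * x j := by
    simp [toEnd, Matrix.toEuclideanLin, Matrix.toLpLin, Matrix.mulVec, dotProduct]
  rw [h]
  rw [← mem_algebraicClosure_iff]
  exact sum_mem fun j _ => mem_algebraicClosure_iff.2 ((isAlgebraic_algebraMap _).mul (hx j))

theorem isAlgebraic_of_hasEigenvalue (L : LTISystem d) {μ : ℝ} (hμ : L.toEnd.HasEigenvalue μ) :
    IsAlgebraic ℚ μ := by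
  have h : L.toEnd.charpoly = L.A.charpoly.map (algebraMap ℚ ℝ) := by
    rw [LTISystem.toEnd, Matrix.toEuclideanLin, Matrix.toLpLin_eq_toLin, Matrix.charpoly_toLin,
      Matrix.charpoly_map]
  rw [Module.End.hasEigenvalue_iff_isRoot_charpoly, h] at hμ
  refine ⟨L.A.charpoly, (Matrix.charpoly_monic _).ne_zero, ?_⟩
  rwa [Polynomial.IsRoot, Polynomial.eval_map_algebraMap] at hμ

/-- The vector representing the linear form `expForm L.toEnd μ j u`. -/
def expVec (L : LTISystem d) (μ : ℝ) (j : ℕ) (u : EuclideanSpace ℝ (Fin d)) :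
    EuclideanSpace ℝ (Fin d) :=
  (μ ^ j)⁻¹ • ((L.toEnd - μ • 1) ^ j) (spectralProj L.toEnd μ u)

theorem inner_expVec (L : LTISystem d) (μ : ℝ) (j : ℕ) (u x : EuclideanSpace ℝ (Fin d)) :
    ⟪L.expVec μ j u, x⟫_ℝ = expForm L.toEnd μ j u x := by
  simp [expVec, expForm, inner_smul_left]

theorem isAlgebraicVector_expVec (L : LTISystem d) {μ : ℝ} (hμ : L.toEnd.HasEigenvalue μ) (j : ℕ)
    {u : EuclideanSpace ℝ (Fin d)} (hu : IsAlgebraicVector u) :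
    IsAlgebraicVector (L.expVec μ j u) := by
  have ha := L.isAlgebraic_of_hasEigenvalue hμ
  have hT : ∀ x, IsAlgebraicVector x → IsAlgebraicVector ((L.toEnd - μ • 1) x) := by
    intro x hx
    exact (L.isAlgebraicVector_toEnd hx).sub fun i => ha.mul (hx i)
  have h := (hu.spectralProj fun x hx => hx.pow_apply hT d).pow_apply hT j
  exact fun i => (ha.pow j).inv.mul (h i)

/-- If the controls are algebraic and eventually constant, the state reached is algebraic. -/
theorem isAlgebraicVector_of_hasSum (L : LTISystem d)
    (h1 : ¬ L.toEnd.HasEigenvalue 1) {w : ℕ → EuclideanSpace ℝ (Fin d)}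
    (hw : ∀ n, IsAlgebraicVector (w n)) {N : ℕ} (hN : ∀ n ≥ N, w n = w N)
    {x : EuclideanSpace ℝ (Fin d)} (hx : HasSum (fun n => (L.toEnd ^ n) (w n)) x) :
    IsAlgebraicVector x := by
  have hT : ∀ x, IsAlgebraicVector x → IsAlgebraicVector ((1 - L.toEnd) x) := fun x hx =>
    hx.sub (L.isAlgebraicVector_toEnd hx)
  have hinj : Function.Injective (1 - L.toEnd : Module.End ℝ (EuclideanSpace ℝ (Fin d))) := by
    rw [← LinearMap.ker_eq_bot, LinearMap.ker_eq_bot']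
    intro v hv
    by_contra h0
    refine h1 (Module.End.hasEigenvalue_of_hasEigenvector (x := v) ⟨?_, h0⟩)
    rw [Module.End.mem_eigenspace_iff, one_smul]
    exact (sub_eq_zero.1 hv).symm
  have hpow : ∀ n {x}, IsAlgebraicVector x → IsAlgebraicVector ((L.toEnd ^ n) x) := fun n x hx =>
    hx.pow_apply (fun _ h => L.isAlgebraicVector_toEnd h) n
  refine IsAlgebraicVector.of_apply hT hinj ?_
  have hc : Continuous L.toEnd := LinearMap.continuous_of_finiteDimensional _
  have hx' : HasSum (fun n => (L.toEnd ^ (n + 1)) (w n)) (L.toEnd x) := by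
    simpa [pow_succ', Function.comp_def] using hx.map L.toEnd hc
  have h2 := (hasSum_nat_add_iff' 1).2 hx
  have h3 : HasSum (fun n => (L.toEnd ^ (n + 1)) (w (n + 1) - w n)) (x - w 0 - L.toEnd x) := by
    simpa [map_sub] using h2.sub hx'
  have h4 := hasSum_sum_of_ne_finset_zero (f := fun n => (L.toEnd ^ (n + 1)) (w (n + 1) - w n))
    (s := Finset.range N) (L := .unconditional ℕ) fun n hn => by
      have hn' : N ≤ n := by simpa using hn
      rw [hN n hn', hN (n + 1) (by omega), sub_self, map_zero]
  have h5 : (1 - L.toEnd) x = w 0 + ∑ n ∈ Finset.range N, (L.toEnd ^ (n + 1)) (w (n + 1) - w n) := by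
    rw [h4.unique h3]
    simp only [LinearMap.sub_apply, Module.End.one_apply]
    abel
  rw [h5]
  exact (algebraicVectors d).add_mem (hw 0) ((algebraicVectors d).sum_mem fun n _ =>
    hpow (n + 1) ((hw (n + 1)).sub (hw n)))

end LTISystem

theorem inner_eq_zero_of_mem_affZero {S : Set (EuclideanSpace ℝ (Fin d))}
    {x τ : EuclideanSpace ℝ (Fin d)} {c : ℝ} (h : ∀ s ∈ S, ⟪s, τ⟫_ℝ = c) (hx : x ∈ affZero S) :
    ⟪x, τ⟫_ℝ = 0 := by
  obtain ⟨m, b, u, hu, hb, rfl⟩ := hx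
  rw [sum_inner]
  simp_rw [inner_smul_left, h _ (hu _)]
  simp [← Finset.sum_mul, hb]

theorem sub_mem_affZero {S : Set (EuclideanSpace ℝ (Fin d))} {x y : EuclideanSpace ℝ (Fin d)}
    (hx : x ∈ S) (hy : y ∈ S) : x - y ∈ affZero S :=
  ⟨2, ![1, -1], ![x, y], fun i => by fin_cases i <;> simp [hx, hy], by simp, by
    simp [sub_eq_add_neg]⟩

namespace IsExtremalVector

variable {K : Set (EuclideanSpace ℝ (Fin d))} {τ x : EuclideanSpace ℝ (Fin d)}

theorem mem_span_of_add_mem_of_sub_mem (h : IsExtremalVector K τ)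
    (hK : ∀ y ∈ K, (2⁻¹ : ℝ) • y ∈ K) (h1 : τ + x ∈ K) (h2 : τ - x ∈ K) :
    x ∈ Submodule.span ℝ {τ} := by
  obtain ⟨⟨a, -, ha⟩, -⟩ := h.2.2 _ (hK _ h1) _ (hK _ h2) (by
    rw [← smul_add, add_add_sub_cancel, ← two_smul ℝ τ, smul_smul]
    norm_num)
  refine Submodule.mem_span_singleton.2 ⟨2 * a - 1, ?_⟩
  have h3 : τ + x = (2 : ℝ) • ((2⁻¹ : ℝ) • (τ + x)) := by
    rw [smul_smul]
    norm_num
  rw [ha, smul_smul] at h3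
  rw [sub_smul, one_smul, ← h3, add_sub_cancel_left]

end IsExtremalVector

theorem smul_mem_sepCone {C D : Set (EuclideanSpace ℝ (Fin d))} {y : EuclideanSpace ℝ (Fin d)}
    {r : ℝ} (hr : 0 ≤ r) (hy : y ∈ sepCone C D) : r • y ∈ sepCone C D := by
  intro u hu v hv
  rw [inner_smul_right, inner_smul_right]
  exact mul_le_mul_of_nonneg_left (hy u hu v hv) hr

theorem nonempty_of_isExtremalVector {C D : Set (EuclideanSpace ℝ (Fin d))}
    {τ : EuclideanSpace ℝ (Fin d)} (h : IsExtremalVector (sepCone C D) τ) : D.Nonempty := by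
  by_contra hD
  rw [Set.not_nonempty_iff_eq_empty] at hD
  obtain ⟨-, b, hb, h'⟩ := h.2.2 ((2 : ℝ) • τ) (by simp [sepCone, hD]) (-τ)
    (by simp [sepCone, hD]) (by rw [two_smul]; abel)
  have h0 : (b + 1) • τ = 0 := by
    rw [add_smul, one_smul, ← h', neg_add_cancel]
  rcases smul_eq_zero.1 h0 with h0 | h0
  · linarith
  · exact h.2.1 h0

/-- An extremal vector of the cone of separators of bounded sets supports both sets at the same
height. -/
theorem inner_eq_of_isExtremalVector {C D : Set (EuclideanSpace ℝ (Fin d))} {R : ℝ}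
    (hC : ∀ x ∈ C, ‖x‖ ≤ R) (hD : ∀ x ∈ D, ‖x‖ ≤ R) (hd : 2 ≤ d ∨ (C ∩ D).Nonempty)
    {τ : EuclideanSpace ℝ (Fin d)} (h : IsExtremalVector (sepCone C D) τ)
    {w q : EuclideanSpace ℝ (Fin d)} (hw : w ∈ maxFace τ C) (hq : q ∈ minFace τ D) :
    ⟪w, τ⟫_ℝ = ⟪q, τ⟫_ℝ := by
  refine (h.1 w hw.1 q hq.1).antisymm ?_
  by_contra! hlt
  rcases hd with hd | ⟨z, hzC, hzD⟩
  · have hR : 0 ≤ R := (norm_nonneg w).trans (hC w hw.1)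
    have hmem : ∀ y : EuclideanSpace ℝ (Fin d), 2 * R * ‖y‖ ≤ ⟪q, τ⟫_ℝ - ⟪w, τ⟫_ℝ →
        τ + y ∈ sepCone C D := by
      intro y hy u hu v hv
      have h1 : ⟪u, y⟫_ℝ ≤ R * ‖y‖ := (real_inner_le_norm u y).trans
        (mul_le_mul_of_nonneg_right (hC u hu) (norm_nonneg y))
      have h2 : -⟪v, y⟫_ℝ ≤ R * ‖y‖ := (neg_le_abs _).trans ((abs_real_inner_le_norm v y).trans
        (mul_le_mul_of_nonneg_right (hD v hv) (norm_nonneg y)))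
      have h3 := hw.2 u hu
      have h4 := hq.2 v hv
      rw [inner_add_right, inner_add_right]
      linarith
    have htop : Submodule.span ℝ {τ} = ⊤ := by
      refine Submodule.eq_top_iff'.2 fun x => ?_
      obtain ⟨ε, hε, hεx⟩ : ∃ ε : ℝ, 0 < ε ∧ 2 * R * (ε * ‖x‖) ≤ ⟪q, τ⟫_ℝ - ⟪w, τ⟫_ℝ := by
        refine ⟨(⟪q, τ⟫_ℝ - ⟪w, τ⟫_ℝ) / (2 * R * ‖x‖ + 1), by
          have := sub_pos.2 hlt
          positivity, ?_⟩
        rw [← mul_assoc, mul_comm (2 * R), mul_assoc, div_mul_eq_mul_div, div_le_iff₀ (by positivity)]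
        exact mul_le_mul_of_nonneg_left (by linarith) (sub_pos.2 hlt).le
      have hn : ‖ε • x‖ = ε * ‖x‖ := by rw [norm_smul, Real.norm_of_nonneg hε.le]
      have hx : ε • x ∈ Submodule.span ℝ {τ} := by
        refine h.mem_span_of_add_mem_of_sub_mem (fun y => smul_mem_sepCone (by norm_num))
          (hmem _ (by rwa [hn])) ?_
        rw [sub_eq_add_neg]
        exact hmem _ (by rwa [norm_neg, hn])
      exact (Submodule.smul_mem_iff _ hε.ne').1 hx
    have := finrank_span_singleton (K := ℝ) h.2.1
    rw [htop, finrank_top, finrank_euclideanSpace_fin] at this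
    omega
  · have h1 := hw.2 z hzC
    have h2 := hq.2 z hzD
    linarith

theorem mem_span_of_abs_le {C D : Set (EuclideanSpace ℝ (Fin d))}
    {τ x w q : EuclideanSpace ℝ (Fin d)} (h : IsExtremalVector (sepCone C D) τ) {M : ℝ}
    (hM : 0 < M) (hw : ⟪w, τ⟫_ℝ = ⟪q, τ⟫_ℝ) (hx : ⟪w - q, x⟫_ℝ = 0)
    (hC : ∀ p ∈ C, |⟪w - p, x⟫_ℝ| ≤ M * ⟪w - p, τ⟫_ℝ)
    (hD : ∀ p ∈ D, |⟪p - q, x⟫_ℝ| ≤ M * ⟪p - q, τ⟫_ℝ) :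
    x ∈ Submodule.span ℝ {τ} := by
  have key : ∀ s : ℝ, |s| = 1 → τ + (M⁻¹ * s) • x ∈ sepCone C D := by
    intro s hs
    have hmem : M • τ + s • x ∈ sepCone C D := by
      intro u hu v hv
      have hb : ∀ t : ℝ, |s * t| = |t| := fun t => by rw [abs_mul, hs, one_mul]
      have h1 := (neg_le_abs _).trans ((hb _).le.trans (hC u hu))
      have h2 := (neg_le_abs _).trans ((hb _).le.trans (hD v hv))
      have h4 : s * ⟪w - q, x⟫_ℝ = 0 := by rw [hx, mul_zero]
      simp only [inner_sub_left, inner_add_right, inner_smul_right, mul_sub] at *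
      rw [hw] at h1
      linarith
    have h1 := smul_mem_sepCone (inv_nonneg.2 hM.le) hmem
    rwa [smul_add, smul_smul, smul_smul, inv_mul_cancel₀ hM.ne', one_smul] at h1
  have h1 := h.mem_span_of_add_mem_of_sub_mem (x := M⁻¹ • x)
    (fun y => smul_mem_sepCone (by norm_num)) (by simpa using key 1 (by simp))
    (by simpa [sub_eq_add_neg] using key (-1) (by simp))
  exact (Submodule.smul_mem_iff _ (inv_ne_zero hM.ne')).1 h1

namespace LTISystem

theorem norm_le_of_mem_reachInf (L : LTISystem d) (hL : L.IsSimple) (hpos : L.HasPositiveSpectrum) :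
    ∃ R, ∀ x ∈ L.reachInf, ‖x‖ ≤ R := by
  obtain ⟨b, hb, hTb⟩ := L.exists_summable_norm_pow_le hL hpos
  obtain ⟨R, hR⟩ := hL.polytope.isCompact.isBounded.exists_norm_le
  have hb' : ∀ n (u : EuclideanSpace ℝ (Fin d)), u ∈ L.U → ‖(L.toEnd ^ n) u‖ ≤ |b n| * R :=
    fun n u hu => (hTb n u).trans (mul_le_mul (le_abs_self _) (hR u hu) (norm_nonneg _)
      (abs_nonneg _))
  refine ⟨(∑' n, |b n| * R), ?_⟩
  rintro x ⟨u, hu, hx⟩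
  rw [← hx.tsum_eq]
  exact tsum_of_norm_bounded (hb.abs.mul_right R).hasSum fun n => hb' n _ (hu n)

theorem summable_pow_apply (L : LTISystem d) (hL : L.IsSimple) (hpos : L.HasPositiveSpectrum)
    {u : ℕ → EuclideanSpace ℝ (Fin d)} (hu : ∀ n, u n ∈ L.U) :
    Summable fun n => (L.toEnd ^ n) (u n) := by
  obtain ⟨b, hb, hTb⟩ := L.exists_summable_norm_pow_le hL hpos
  obtain ⟨R, hR⟩ := hL.polytope.isCompact.isBounded.exists_norm_le
  exact Summable.of_norm_bounded (hb.abs.mul_right R) fun n => (hTb n _).trans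
    (mul_le_mul (le_abs_self _) (hR _ (hu n)) (norm_nonneg _) (abs_nonneg _))

theorem extremePoints_nonempty (L : LTISystem d) (hL : L.IsSimple) :
    (L.U.extremePoints ℝ).Nonempty := by
  obtain ⟨r, hr, h⟩ := hL.zero_mem_relint
  have h0 : (0 : EuclideanSpace ℝ (Fin d)) ∈ L.U :=
    h ⟨Metric.mem_ball_self hr, Submodule.zero_mem _⟩
  rw [← hL.polytope.convexHull_extremePoints] at h0
  exact convexHull_nonempty_iff.1 ⟨0, h0⟩

/-- The linear form `u ↦ ⟨A^n u, τ⟩`. -/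
def innerPow (L : LTISystem d) (n : ℕ) (τ : EuclideanSpace ℝ (Fin d)) :
    EuclideanSpace ℝ (Fin d) →ₗ[ℝ] ℝ :=
  innerₗ (EuclideanSpace ℝ (Fin d)) τ ∘ₗ L.toEnd ^ n

theorem innerPow_apply (L : LTISystem d) (n : ℕ) (τ u : EuclideanSpace ℝ (Fin d)) :
    L.innerPow n τ u = ⟪(L.toEnd ^ n) u, τ⟫_ℝ := by
  simp [innerPow, real_inner_comm]

/-- For each time `n` a vertex of `U` that is optimal in direction `τ`, eventually constant. -/
theorem exists_optimal_controls (L : LTISystem d) (hL : L.IsSimple) (hpos : L.HasPositiveSpectrum)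
    (τ : EuclideanSpace ℝ (Fin d)) :
    ∃ w : ℕ → EuclideanSpace ℝ (Fin d), (∀ n, w n ∈ L.U.extremePoints ℝ ∧
      ∀ v ∈ L.U.extremePoints ℝ, L.innerPow n τ v ≤ L.innerPow n τ (w n)) ∧
      ∃ N, ∀ n ≥ N, w n = w N := by
  refine exists_eventually_max hL.polytope.finite_extremePoints (L.extremePoints_nonempty hL)
    (fun v n => L.innerPow n τ v) fun u v => ?_
  refine (L.eventually_sign_inner_pow hpos (u - v) τ).imp ?_ ?_ <;>
  · refine fun h => h.mono fun n hn => ?_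
    rw [← innerPow_apply, map_sub] at hn
    linarith

theorem exists_abs_innerPow_le (L : LTISystem d) (hL : L.IsSimple) (hpos : L.HasPositiveSpectrum)
    {τ x : EuclideanSpace ℝ (Fin d)} (hx : x ∈ L.dom τ) {w : ℕ → EuclideanSpace ℝ (Fin d)}
    (hw : ∀ n, w n ∈ L.U.extremePoints ℝ ∧
      ∀ v ∈ L.U.extremePoints ℝ, L.innerPow n τ v ≤ L.innerPow n τ (w n))
    (hwx : ∀ n, ∀ v ∈ L.U.extremePoints ℝ, L.innerPow n τ v = L.innerPow n τ (w n) →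
      L.innerPow n x v = L.innerPow n x (w n)) :
    ∃ M : ℝ, 0 ≤ M ∧ ∀ n, ∀ u ∈ L.U, |L.innerPow n x (w n - u)| ≤ M * L.innerPow n τ (w n - u) := by
  have hfin := hL.polytope.finite_extremePoints
  have hpair : ∀ p : EuclideanSpace ℝ (Fin d) × EuclideanSpace ℝ (Fin d),
      ∃ M : ℝ, p ∈ (L.U.extremePoints ℝ) ×ˢ (L.U.extremePoints ℝ) →
        ∀ n, L.innerPow n τ (p.1 - p.2) ≠ 0 →
          |L.innerPow n x (p.1 - p.2)| ≤ M * |L.innerPow n τ (p.1 - p.2)| := by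
    rintro ⟨u, v⟩
    by_cases hp : (u, v) ∈ (L.U.extremePoints ℝ) ×ˢ (L.U.extremePoints ℝ)
    · have h1 := L.isBigO_inner_pow hpos (y := u - v) (τ := τ) (τ' := x)
        (hx u hp.1 v hp.2)
      simp_rw [← innerPow_apply] at h1
      have h2 : (fun n => if L.innerPow n τ (u - v) = 0 then 0 else L.innerPow n x (u - v))
          =O[atTop] fun n => L.innerPow n τ (u - v) := by
        refine IsBigO.trans (IsBigO.of_bound 1 (Eventually.of_forall fun n => ?_)) h1
        split_ifs <;> simp
      obtain ⟨M, hM⟩ := (isBigO_nat_atTop_iff fun n hn => by simp [hn]).1 h2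
      refine ⟨M, fun _ n hn => ?_⟩
      have h3 := hM n
      rwa [if_neg hn] at h3
    · exact ⟨0, fun h => absurd h hp⟩
  choose Mf hMf using hpair
  obtain ⟨M, hM⟩ := ((hfin.prod hfin).image Mf).bddAbove
  refine ⟨max M 0, le_max_right _ _, fun n u hu => ?_⟩
  rw [← hL.polytope.convexHull_extremePoints] at hu
  refine abs_le_of_mem_convexHull (fun v hv => ?_) u hu
  have hnn : 0 ≤ L.innerPow n τ (w n - v) := by
    rw [map_sub]
    exact sub_nonneg.2 ((hw n).2 v hv)
  by_cases h0 : L.innerPow n τ (w n - v) = 0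
  · have h1 := hwx n v hv (by
      rw [map_sub] at h0
      linarith)
    rw [h0, map_sub, h1]
    simp
  · have hp : (w n, v) ∈ (L.U.extremePoints ℝ) ×ˢ (L.U.extremePoints ℝ) := ⟨(hw n).1, hv⟩
    have h1 := hMf (w n, v) hp n h0
    rw [abs_of_nonneg hnn] at h1
    exact h1.trans (mul_le_mul_of_nonneg_right
      ((hM (Set.mem_image_of_mem _ hp)).trans (le_max_left _ _)) hnn)

theorem abs_inner_sub_le_of_mem_reachInf (L : LTISystem d)
    {τ x W : EuclideanSpace ℝ (Fin d)} {w : ℕ → EuclideanSpace ℝ (Fin d)} {M : ℝ}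
    (h : ∀ n, ∀ u ∈ L.U, |L.innerPow n x (w n - u)| ≤ M * L.innerPow n τ (w n - u))
    (hW : HasSum (fun n => (L.toEnd ^ n) (w n)) W) :
    ∀ p ∈ L.reachInf, |⟪W - p, x⟫_ℝ| ≤ M * ⟪W - p, τ⟫_ℝ := by
  rintro p ⟨u, hu, hp⟩
  have hs : ∀ y : EuclideanSpace ℝ (Fin d),
      HasSum (fun n => L.innerPow n y (w n - u n)) ⟪W - p, y⟫_ℝ := by
    intro y
    have := (hW.sub hp).mapL (innerSL ℝ y)
    simpa [innerPow, real_inner_comm] using this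
  rw [← (hs x).tsum_eq]
  exact tsum_of_norm_bounded (f := fun n => L.innerPow n x (w n - u n)) ((hs τ).mul_left M)
    fun n => h n _ (hu n)

end LTISystem

theorem IsConvexPolytope.exists_extremePoint_mem_minFace {Q : Set (EuclideanSpace ℝ (Fin d))}
    (hQ : IsConvexPolytope Q) (hne : Q.Nonempty) (τ : EuclideanSpace ℝ (Fin d)) :
    ∃ q ∈ Q.extremePoints ℝ, q ∈ minFace τ Q := by
  have hne' : (Q.extremePoints ℝ).Nonempty := by
    rw [← hQ.convexHull_extremePoints] at hne
    exact convexHull_nonempty_iff.1 hne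
  obtain ⟨q, hq, hmin⟩ := Set.exists_min_image (Q.extremePoints ℝ) (fun v => ⟪v, τ⟫_ℝ)
    hQ.finite_extremePoints hne'
  refine ⟨q, hq, hq.1, fun v hv => ?_⟩
  rw [← hQ.convexHull_extremePoints] at hv
  have := le_of_mem_convexHull_of_forall_le (f := -innerₗ (EuclideanSpace ℝ (Fin d)) τ) (w := q)
    (V := Q.extremePoints ℝ) (fun u hu => by simpa [real_inner_comm] using hmin u hu) v hv
  simpa [real_inner_comm] using this

theorem IsConvexPolytope.exists_abs_inner_sub_le {Q : Set (EuclideanSpace ℝ (Fin d))}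
    (hQ : IsConvexPolytope Q) {τ x q : EuclideanSpace ℝ (Fin d)} (hq : q ∈ minFace τ Q)
    (h : ∀ v ∈ Q.extremePoints ℝ, ⟪v, τ⟫_ℝ = ⟪q, τ⟫_ℝ → ⟪v, x⟫_ℝ = ⟪q, x⟫_ℝ) :
    ∃ M : ℝ, 0 ≤ M ∧ ∀ p ∈ Q, |⟪p - q, x⟫_ℝ| ≤ M * ⟪p - q, τ⟫_ℝ := by
  obtain ⟨M, hM, hb⟩ := exists_abs_le_of_finite (V := Q.extremePoints ℝ) (w := q)
    (f := -innerₗ (EuclideanSpace ℝ (Fin d)) τ) (g := -innerₗ (EuclideanSpace ℝ (Fin d)) x)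
    hQ.finite_extremePoints
    (fun v hv => by simpa [real_inner_comm] using hq.2 v hv.1)
    (fun v hv h' => by
      simpa [real_inner_comm] using h v hv (by simpa [real_inner_comm] using h'))
  refine ⟨M, hM, fun p hp => ?_⟩
  rw [← hQ.convexHull_extremePoints] at hp
  have := abs_le_of_mem_convexHull hb p hp
  rw [LinearMap.neg_apply, LinearMap.neg_apply, ← map_neg, ← map_neg, neg_sub] at this
  simpa only [innerₗ_apply_apply, real_inner_comm] using this

namespace LTISystem

/-- The equations for `τ` derived from the vertices of `U` and `Q`, given optimal controls `w` with
sum `W` and a minimal vertex `q` of `Q`. -/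
def separatorEqs (L : LTISystem d) (Q : Set (EuclideanSpace ℝ (Fin d)))
    (τ W q : EuclideanSpace ℝ (Fin d)) (w : ℕ → EuclideanSpace ℝ (Fin d)) :
    Set (EuclideanSpace ℝ (Fin d)) :=
  {a | ∃ u ∈ L.U.extremePoints ℝ, ∃ u' ∈ L.U.extremePoints ℝ, ∃ μ : ℝ, L.toEnd.HasEigenvalue μ ∧
      ∃ j < d, expForm L.toEnd μ j (u - u') τ = 0 ∧ a = L.expVec μ j (u - u')} ∪
    {a | ∃ n, ∃ v ∈ L.U.extremePoints ℝ, L.innerPow n τ v = L.innerPow n τ (w n) ∧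
      a = (L.toEnd ^ n) (w n - v)} ∪
    {a | ∃ v ∈ Q.extremePoints ℝ, ⟪v, τ⟫_ℝ = ⟪q, τ⟫_ℝ ∧ a = v - q} ∪ {W - q}

section

variable {L : LTISystem d} {Q : Set (EuclideanSpace ℝ (Fin d))}
  {τ x W q : EuclideanSpace ℝ (Fin d)} {w : ℕ → EuclideanSpace ℝ (Fin d)}

theorem isAlgebraicVector_of_mem_separatorEqs (hU : ∀ v ∈ L.U.extremePoints ℝ, IsAlgebraicVector v)
    (hQ : ∀ v ∈ Q.extremePoints ℝ, IsAlgebraicVector v) (hw : ∀ n, w n ∈ L.U.extremePoints ℝ)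
    (hW : IsAlgebraicVector W) (hq : q ∈ Q.extremePoints ℝ) :
    ∀ a ∈ L.separatorEqs Q τ W q w, IsAlgebraicVector a := by
  rintro a (((⟨u, hu, u', hu', μ, hμ, j, -, -, rfl⟩ | ⟨n, v, hv, -, rfl⟩) | ⟨v, hv, -, rfl⟩) | rfl)
  · exact L.isAlgebraicVector_expVec hμ j ((hU u hu).sub (hU u' hu'))
  · exact ((hU _ (hw n)).sub (hU v hv)).pow_apply (fun _ h => L.isAlgebraicVector_toEnd h) n
  · exact (hQ v hv).sub (hQ q hq)
  · exact hW.sub (hQ q hq)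

theorem mem_maxFace_of_hasSum (hL : L.IsSimple)
    (hw : ∀ n, w n ∈ L.U.extremePoints ℝ ∧
      ∀ v ∈ L.U.extremePoints ℝ, L.innerPow n τ v ≤ L.innerPow n τ (w n))
    (hW : HasSum (fun n => (L.toEnd ^ n) (w n)) W) : W ∈ maxFace τ L.reachInf := by
  refine ⟨⟨w, fun n => (hw n).1.1, hW⟩, ?_⟩
  intro p hp
  have h := L.abs_inner_sub_le_of_mem_reachInf (x := 0) (τ := τ) (M := 1) (fun n u hu => by
    rw [← hL.polytope.convexHull_extremePoints] at hu
    have := le_of_mem_convexHull_of_forall_le (hw n).2 u hu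
    rw [innerPow_apply, inner_zero_right, map_sub]
    simpa using this) hW p hp
  simpa [inner_sub_left] using h

theorem inner_eq_zero_of_mem_separatorEqs
    (hx : x ∈ L.dom τ ⊓ (affZero (maxFace τ L.reachInf ∪ minFace τ Q))ᗮ)
    (hw : ∀ n, w n ∈ L.U.extremePoints ℝ)
    (hW : HasSum (fun n => (L.toEnd ^ n) (w n)) W) (hWmax : W ∈ maxFace τ L.reachInf)
    (hq : q ∈ minFace τ Q) : ∀ a ∈ L.separatorEqs Q τ W q w, ⟪a, x⟫_ℝ = 0 := by
  obtain ⟨hdom, haff⟩ := hx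
  rintro a (((⟨u, hu, u', hu', μ, hμ, j, hj, h0, rfl⟩ | ⟨n, v, hv, h, rfl⟩) | ⟨v, hv, h, rfl⟩) | rfl)
  · rw [L.inner_expVec]
    exact hdom u hu u' hu' μ hμ j hj h0
  · have hW' := hW.update n ((L.toEnd ^ n) v)
    have hmem : (L.toEnd ^ n) v - (L.toEnd ^ n) (w n) + W ∈ maxFace τ L.reachInf := by
      refine ⟨⟨Function.update w n v, fun i => ?_, ?_⟩, fun p hp => ?_⟩
      · rcases eq_or_ne i n with rfl | hi
        · simpa using hv.1
        · simpa [hi] using (hw i).1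
      · convert! hW' using 1
        funext i
        rcases eq_or_ne i n with rfl | hi
        · simp
        · simp [hi]
      · rw [inner_add_left, inner_sub_left, ← innerPow_apply, ← innerPow_apply, h, sub_self,
          zero_add]
        exact hWmax.2 p hp
    have := haff _ (sub_mem_affZero (Or.inl hWmax) (Or.inl hmem))
    rwa [sub_add_eq_sub_sub_swap, sub_self, zero_sub, neg_sub, ← map_sub] at this
  · exact haff _ (sub_mem_affZero (Or.inr ⟨hv.1, fun p hp => h.le.trans (hq.2 p hp)⟩) (Or.inr hq))
  · exact haff _ (sub_mem_affZero (Or.inl hWmax) (Or.inr hq))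

theorem mem_span_of_inner_separatorEqs (hL : L.IsSimple) (hpos : L.HasPositiveSpectrum)
    (hQ : IsConvexPolytope Q) (hτ : IsExtremalVector (sepCone L.reachInf Q) τ)
    (hw : ∀ n, w n ∈ L.U.extremePoints ℝ ∧
      ∀ v ∈ L.U.extremePoints ℝ, L.innerPow n τ v ≤ L.innerPow n τ (w n))
    (hW : HasSum (fun n => (L.toEnd ^ n) (w n)) W) (hq : q ∈ minFace τ Q)
    (hWq : ⟪W, τ⟫_ℝ = ⟪q, τ⟫_ℝ) (hx : ∀ a ∈ L.separatorEqs Q τ W q w, ⟪a, x⟫_ℝ = 0) :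
    x ∈ Submodule.span ℝ {τ} := by
  have hdom : x ∈ L.dom τ := by
    intro u hu u' hu' μ hμ j hj h0
    rw [← L.inner_expVec]
    exact hx _ (Or.inl (Or.inl (Or.inl ⟨u, hu, u', hu', μ, hμ, j, hj, h0, rfl⟩)))
  obtain ⟨M₁, hM₁, hb₁⟩ := L.exists_abs_innerPow_le hL hpos hdom hw (fun n v hv h => by
    have := hx _ (Or.inl (Or.inl (Or.inr ⟨n, v, hv, h, rfl⟩)))
    rw [← innerPow_apply, map_sub] at this
    linarith)
  obtain ⟨M₂, hM₂, hb₂⟩ := hQ.exists_abs_inner_sub_le hq (x := x) (fun v hv h => by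
    have := hx _ (Or.inl (Or.inr ⟨v, hv, h, rfl⟩))
    rw [inner_sub_left] at this
    linarith)
  refine mem_span_of_abs_le hτ (M := M₁ + M₂ + 1) (by positivity) hWq (hx _ (Or.inr rfl))
    (fun p hp => ?_) (fun p hp => ?_)
  · have h0 : 0 ≤ ⟪W - p, τ⟫_ℝ := by
      rw [inner_sub_left]
      exact sub_nonneg.2 ((mem_maxFace_of_hasSum hL hw hW).2 p hp)
    exact (L.abs_inner_sub_le_of_mem_reachInf hb₁ hW p hp).trans
      (mul_le_mul_of_nonneg_right (by linarith) h0)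
  · have h0 : 0 ≤ ⟪p - q, τ⟫_ℝ := by
      rw [inner_sub_left]
      exact sub_nonneg.2 (hq.2 p hp)
    exact (hb₂ p hp).trans (mul_le_mul_of_nonneg_right (by linarith) h0)

theorem mem_dom_inf_orthogonal_affZero (hmax : W ∈ maxFace τ L.reachInf) (hq : q ∈ minFace τ Q)
    (hWq : ⟪W, τ⟫_ℝ = ⟪q, τ⟫_ℝ) :
    τ ∈ L.dom τ ⊓ (affZero (maxFace τ L.reachInf ∪ minFace τ Q))ᗮ := by
  refine ⟨fun _ _ _ _ _ _ _ _ h => h, fun a ha =>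
    inner_eq_zero_of_mem_affZero (c := ⟪q, τ⟫_ℝ) ?_ ha⟩
  rintro s (hs | hs)
  · exact ((hmax.2 s hs.1).antisymm (hs.2 W hmax.1)).trans hWq
  · exact (hs.2 q hq.1).antisymm (hq.2 s hs.1)

end

end LTISystem

end

theorem mainTheorem3 (d : ℕ) (L : LTISystem d) (hL : L.IsSimple)
    (hpos : L.HasPositiveSpectrum) (hfull : affineSpan ℝ L.reach = ⊤)
    (Q : Set (EuclideanSpace ℝ (Fin d))) (hQ : IsConvexPolytope Q)
    (hd : 2 ≤ d ∨ (L.reachInf ∩ Q).Nonempty)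
    (τ : EuclideanSpace ℝ (Fin d)) (hτ : IsExtremalVector (sepCone L.reachInf Q) τ) :
    L.dom τ ⊓ (affZero (maxFace τ L.reachInf ∪ minFace τ Q))ᗮ = Submodule.span ℝ {τ} ∧
    ((∀ v ∈ L.U.extremePoints ℝ, IsAlgebraicVector v) →
      (∀ v ∈ Q.extremePoints ℝ, IsAlgebraicVector v) →
      ∃ F : Finset (EuclideanSpace ℝ (Fin d)), (∀ a ∈ F, IsAlgebraicVector a) ∧
        ∀ x : EuclideanSpace ℝ (Fin d),
          x ∈ L.dom τ ⊓ (affZero (maxFace τ L.reachInf ∪ minFace τ Q))ᗮ ↔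
            ∀ a ∈ F, ⟪a, x⟫_ℝ = 0) := by
  obtain ⟨w, hw, N, hN⟩ := L.exists_optimal_controls hL hpos τ
  obtain ⟨W, hW⟩ := L.summable_pow_apply hL hpos (u := w) fun n => (hw n).1.1
  obtain ⟨q, hqe, hq⟩ :=
    hQ.exists_extremePoint_mem_minFace (nonempty_of_isExtremalVector hτ) τ
  have hmax := LTISystem.mem_maxFace_of_hasSum hL hw hW
  obtain ⟨R₁, hR₁⟩ := L.norm_le_of_mem_reachInf hL hpos
  obtain ⟨R₂, hR₂⟩ := hQ.isCompact.isBounded.exists_norm_le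
  have hWq := inner_eq_of_isExtremalVector (R := max R₁ R₂)
    (fun x hx => (hR₁ x hx).trans (le_max_left _ _))
    (fun x hx => (hR₂ x hx).trans (le_max_right _ _)) hd hτ hmax hq
  have hspan : Submodule.span ℝ {τ} ≤
      L.dom τ ⊓ (affZero (maxFace τ L.reachInf ∪ minFace τ Q))ᗮ := by
    rw [Submodule.span_singleton_le_iff_mem]
    exact LTISystem.mem_dom_inf_orthogonal_affZero hmax hq hWq
  have heqs : ∀ x, x ∈ L.dom τ ⊓ (affZero (maxFace τ L.reachInf ∪ minFace τ Q))ᗮ →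
      ∀ a ∈ L.separatorEqs Q τ W q w, ⟪a, x⟫_ℝ = 0 := fun x hx =>
    LTISystem.inner_eq_zero_of_mem_separatorEqs hx (fun n => (hw n).1) hW hmax hq
  have hmem : ∀ x, (∀ a ∈ L.separatorEqs Q τ W q w, ⟪a, x⟫_ℝ = 0) →
      x ∈ Submodule.span ℝ {τ} := fun x =>
    LTISystem.mem_span_of_inner_separatorEqs hL hpos hQ hτ hw hW hq hWq
  refine ⟨le_antisymm (fun x hx => hmem x (heqs x hx)) hspan, fun hUa hQa => ?_⟩
  obtain ⟨F, hFG, hF⟩ := exists_finset_inner_eq_zero_iff (L.separatorEqs Q τ W q w)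
  have h1 : ¬ L.toEnd.HasEigenvalue 1 := fun h =>
    lt_irrefl _ (L.lt_one_of_hasEigenvalue hL one_pos h)
  have hWa : IsAlgebraicVector W :=
    L.isAlgebraicVector_of_hasSum h1 (fun n => hUa _ (hw n).1) hN hW
  refine ⟨F, fun a ha => LTISystem.isAlgebraicVector_of_mem_separatorEqs hUa hQa
    (fun n => (hw n).1) hWa hqe a (hFG ha), fun x => ?_⟩
  rw [hF x]
  exact ⟨heqs x, fun h => hspan (hmem x h)⟩
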